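/- Let $n\ge 1$, let $P_1,\dots,P_n$ be positive definite complex $d\times d$ matrices with sum $P:=\sum_{i=1}^n P_i$, and let $Q$ be a positive definite complex $d\times d$ matrix. For positive semidefinite $A,B$ let $F(A,B):=\operatorname{Tr}\sqrt{B^{1/2}AB^{1/2}}$ be the square-root fidelity and $\mathrm B(A,B):=\operatorname{Tr}[A+B]-2F(A,B)$ the squared Bures distance; let $A\star B:=B^{1/2}AB^{1/2}$ for positive semidefinite $B$, and let $A\#B:=A^{1/2}\sqrt{A^{-1/2}BA^{-1/2}}\,A^{1/2}$ be the geometric mean of positive definite $A,B$. Let $$\mathrm{Dec}_n(Q):=\Big\{(R_1,\dots,R_n) : R_i \text{ positive semidefinite},\ \sum_{i=1}^n R_i=Q\Big\}.$$ Put $$Q_i := P_i\star (P^{-1}\#Q)^2=(P^{-1}\#Q)\,P_i\,(P^{-1}\#Q),\qquad i=1,\dots,n.$$ Then each $Q_i$ is positive definite, and $(Q_1,\dots,Q_n)$ is the unique minimizer of the total squared Bures distance $\sum_{i=1}^n \mathrm B(P_i,R_i)$ over $(R_1,\dots,R_n)\in\mathrm{Dec}_n(Q)$. Equivalently, it is the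 unique maximizer of the total square-root fidelity $\sum_{i=1}^n F(P_i,R_i)$ over $\mathrm{Dec}_n(Q)$. -/

import Mathlib

open scoped ComplexOrder MatrixOrder

namespace BuresProjection

/-- The star product `A ⋆ B = B^{1/2} A B^{1/2}`, for `B` positive semidefinite. -/
noncomputable def starProd {d : ℕ} (A B : Matrix (Fin d) (Fin d) ℂ) :
    Matrix (Fin d) (Fin d) ℂ :=
  CFC.sqrt B * A * CFC.sqrt B

/-- The matrix geometric mean `A # B = A^{1/2} (A^{-1/2} B A^{-1/2})^{1/2} A^{1/2}` of positive
definite matrices. -/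
noncomputable def geomMean {d : ℕ} (A B : Matrix (Fin d) (Fin d) ℂ) :
    Matrix (Fin d) (Fin d) ℂ :=
  CFC.sqrt A * CFC.sqrt ((CFC.sqrt A)⁻¹ * B * (CFC.sqrt A)⁻¹) * CFC.sqrt A

/-- The square-root fidelity `F(P, Q) = Tr (Q^{1/2} P Q^{1/2})^{1/2}` of positive semidefinite
matrices; this trace is real, being the trace of a positive semidefinite matrix. -/
noncomputable def fidelity {d : ℕ} (P Q : Matrix (Fin d) (Fin d) ℂ) : ℝ :=
  (CFC.sqrt (CFC.sqrt Q * P * CFC.sqrt Q)).trace.re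

/-- The squared Bures distance `B(P, Q) = Tr (P + Q) - 2 F(P, Q)` of positive semidefinite
matrices. -/
noncomputable def buresSq {d : ℕ} (P Q : Matrix (Fin d) (Fin d) ℂ) : ℝ :=
  (P + Q).trace.re - 2 * fidelity P Q

/-- The squared Bures distance of two ensembles of equal length. -/
noncomputable def ensembleBuresSq {d n : ℕ} (P Q : Fin n → Matrix (Fin d) (Fin d) ℂ) : ℝ :=
  ∑ i, buresSq (P i) (Q i)

/-- The total square-root fidelity of two ensembles of equal length. -/
noncomputable def ensembleFidelity {d n : ℕ} (P Q : Fin n → Matrix (Fin d) (Fin d) ℂ) : ℝ :=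
  ∑ i, fidelity (P i) (Q i)

/-- The set of decompositions of `Q` into `n` positive semidefinite matrices. -/
def decompositions {d : ℕ} (n : ℕ) (Q : Matrix (Fin d) (Fin d) ℂ) :
    Set (Fin n → Matrix (Fin d) (Fin d) ℂ) :=
  {R | (∀ i, (R i).PosSemidef) ∧ ∑ i, R i = Q}

/-- The set of Bures projections of the ensemble `P` onto the decompositions of `Q`, that is,
the minimizers of the squared Bures distance to `P`. -/
def ensembleProjections {d n : ℕ} (P : Fin n → Matrix (Fin d) (Fin d) ℂ)
    (Q : Matrix (Fin d) (Fin d) ℂ) : Set (Fin n → Matrix (Fin d) (Fin d) ℂ) :=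
  {R ∈ decompositions n Q | IsMinOn (ensembleBuresSq P) (decompositions n Q) R}

/-- The set of fidelity projections of the ensemble `P` onto the decompositions of `Q`, that is,
the maximizers of the total square-root fidelity with `P`. -/
def ensembleFidelityProjections {d n : ℕ} (P : Fin n → Matrix (Fin d) (Fin d) ℂ)
    (Q : Matrix (Fin d) (Fin d) ℂ) : Set (Fin n → Matrix (Fin d) (Fin d) ℂ) :=
  {R ∈ decompositions n Q | IsMaxOn (ensembleFidelity P) (decompositions n Q) R}

end BuresProjection

open Matrix

namespace BuresProjection

/-! The proof is by a dual certificate. For positive definite `M`, completing a square gives `2 F(A,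
R) ≤ Tr A M + Tr R M⁻¹`, with equality exactly at `R = M A M` (`two_fidelity_le`, `fidelity_conj`).
Apply this to every pair `(P i, R i)` with one common `M`: the bounds sum to `Tr (∑ P i) M + Tr Q
M⁻¹`, the same for all decompositions of `Q`. The point `M * P i * M` attains all bounds at once and
is feasible when `M (∑ P i) M = Q`, the Riccati equation solved by `M = (∑ P i)⁻¹ # Q`. -/

section Polar

variable {m : Type*} [Fintype m] [DecidableEq m]

/-- Every Hermitian matrix has a Hermitian generalized inverse `T` with `T S T = T` and
`T S S = S`. -/
lemma exists_generalizedInverse {S : Matrix m m ℂ} (hS : S.IsHermitian) :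
    ∃ T : Matrix m m ℂ, T.IsHermitian ∧ T * S * T = T ∧ T * S * S = S := by
  have hSa : IsSelfAdjoint S := hS
  -- The spectrum is finite, so even `x⁻¹` with `0⁻¹ = 0` is admissible; that convention makes `T` a
  -- pseudo-inverse.
  have hc : ∀ f : ℝ → ℝ, ContinuousOn f (spectrum ℝ S) := fun f =>
    (Matrix.finite_real_spectrum (A := S)).continuousOn f
  have hid : cfc (fun x : ℝ => x) S = S := cfc_id' ℝ S
  have hmul : ∀ f : ℝ → ℝ, cfc f S * S = cfc (fun x : ℝ => f x * x) S := fun f => by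
    rw [cfc_mul f (fun x => x) S (hc _) (hc _), hid]
  have hTS := hmul fun x => x⁻¹
  refine ⟨cfc (fun x : ℝ => x⁻¹) S, cfc_predicate _ S, ?_, ?_⟩
  · rw [hTS, ← cfc_mul _ _ S (hc _) (hc _)]
    congr 1
    funext x
    rcases eq_or_ne x 0 with rfl | hx
    · simp
    · field_simp
  · rw [hTS, hmul]
    conv_rhs => rw [← hid]
    congr 1
    funext x
    rcases eq_or_ne x 0 with rfl | hx
    · simp
    · field_simp

/-- Polar decomposition with a partial isometry. -/
lemma exists_partialIsometry {S Y : Matrix m m ℂ} (hS : S.IsHermitian) (hSY : S * S = Yᴴ * Y) :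
    ∃ U : Matrix m m ℂ, Uᴴ * Y = S ∧ U * Uᴴ * (U * Uᴴ) = U * Uᴴ := by
  obtain ⟨T, hT, hTST, hTSS⟩ := exists_generalizedInverse hS
  refine ⟨Y * T, ?_, ?_⟩
  · rw [conjTranspose_mul, hT.eq, Matrix.mul_assoc, ← hSY, ← Matrix.mul_assoc, hTSS]
  · rw [conjTranspose_mul, hT.eq]
    calc Y * T * (T * Yᴴ) * (Y * T * (T * Yᴴ))
        = Y * (T * T * (Yᴴ * Y) * T * T) * Yᴴ := by simp only [Matrix.mul_assoc]
      _ = Y * (T * (T * S * S) * T * T) * Yᴴ := by rw [← hSY]; simp only [Matrix.mul_assoc]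
      _ = Y * (T * S * T * T) * Yᴴ := by rw [hTSS]
      _ = Y * T * (T * Yᴴ) := by rw [hTST]; simp only [Matrix.mul_assoc]

end Polar

lemma posDef_sqrt {d : ℕ} {A : Matrix (Fin d) (Fin d) ℂ} (hA : A.PosDef) :
    (CFC.sqrt A).PosDef :=
  ((CFC.sqrt_nonneg A).posSemidef.posDef_iff_isUnit).2
    ((CFC.isUnit_sqrt_iff A hA.posSemidef.nonneg).2 hA.isUnit)

lemma posDef_conj {d : ℕ} {A B : Matrix (Fin d) (Fin d) ℂ} (hA : A.PosDef) (hB : B.PosDef) :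
    (B * A * B).PosDef := by
  have h := (hB.isUnit.posDef_star_left_conjugate_iff (x := A)).2 hA
  rwa [star_eq_conjTranspose, hB.isHermitian.eq] at h

lemma posDef_geomMean {d : ℕ} {A B : Matrix (Fin d) (Fin d) ℂ} (hA : A.PosDef) (hB : B.PosDef) :
    (geomMean A B).PosDef :=
  posDef_conj (posDef_sqrt (posDef_conj hB (posDef_sqrt hA).inv)) (posDef_sqrt hA)

/-- The geometric mean `X = A # B` solves the Riccati equation `X A⁻¹ X = B`. -/
lemma geomMean_riccati {d : ℕ} {A B : Matrix (Fin d) (Fin d) ℂ} (hA : A.PosDef) (hB : B.PosDef) :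
    geomMean A B * A⁻¹ * geomMean A B = B := by
  unfold geomMean
  set a := CFC.sqrt A with ha
  set s := CFC.sqrt (a⁻¹ * B * a⁻¹) with hs
  have had : a.PosDef := posDef_sqrt hA
  have hdet : IsUnit a.det := (Matrix.isUnit_iff_isUnit_det a).1 had.isUnit
  have haa : a * a = A := CFC.sqrt_mul_sqrt_self A hA.posSemidef.nonneg
  have hss : s * s = a⁻¹ * B * a⁻¹ :=
    CFC.sqrt_mul_sqrt_self _ (posDef_conj hB had.inv).posSemidef.nonneg
  have h1 : a * a⁻¹ = 1 := Matrix.mul_nonsing_inv a hdet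
  have h2 : a⁻¹ * a = 1 := Matrix.nonsing_inv_mul a hdet
  calc a * s * a * A⁻¹ * (a * s * a)
      = a * s * (a * a⁻¹) * (a⁻¹ * a) * s * a := by
        rw [← haa, Matrix.mul_inv_rev]; simp only [Matrix.mul_assoc]
    _ = a * (s * s) * a := by rw [h1, h2]; simp only [Matrix.mul_assoc, Matrix.one_mul]
    _ = (a * a⁻¹) * B * (a⁻¹ * a) := by rw [hss]; simp only [Matrix.mul_assoc]
    _ = B := by rw [h1, h2, Matrix.one_mul, Matrix.mul_one]

/-- The square-root fidelity is at most `(Tr A M + Tr R M⁻¹) / 2` for every positive definite `M`,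
and equality forces `R = M A M`. -/
lemma two_fidelity_le {d : ℕ} {A R M : Matrix (Fin d) (Fin d) ℂ} (hA : A.PosDef)
    (hR : R.PosSemidef) (hM : M.PosDef) :
    2 * fidelity A R ≤ (A * M).trace.re + (R * M⁻¹).trace.re ∧
      (2 * fidelity A R = (A * M).trace.re + (R * M⁻¹).trace.re → R = M * A * M) := by
  have hX : (CFC.sqrt R).IsHermitian := (CFC.sqrt_nonneg R).posSemidef.isHermitian
  have hXX : CFC.sqrt R * CFC.sqrt R = R := CFC.sqrt_mul_sqrt_self R hR.nonneg
  have had : (CFC.sqrt A).PosDef := posDef_sqrt hA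
  have ha : (CFC.sqrt A).IsHermitian := had.isHermitian
  have haa : CFC.sqrt A * CFC.sqrt A = A := CFC.sqrt_mul_sqrt_self A hA.posSemidef.nonneg
  unfold fidelity
  set X := CFC.sqrt R
  set a := CFC.sqrt A
  have hXAX : (X * A * X).PosSemidef := by
    have h := hA.posSemidef.conjTranspose_mul_mul_same X
    rwa [hX.eq] at h
  have hSS : CFC.sqrt (X * A * X) * CFC.sqrt (X * A * X) = (a * X)ᴴ * (a * X) := by
    rw [CFC.sqrt_mul_sqrt_self _ hXAX.nonneg, conjTranspose_mul, hX.eq, ha.eq, ← haa]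
    simp only [Matrix.mul_assoc]
  have hS : (CFC.sqrt (X * A * X)).IsHermitian := (CFC.sqrt_nonneg _).posSemidef.isHermitian
  set S := CFC.sqrt (X * A * X)
  obtain ⟨U, hUS, hU⟩ := exists_partialIsometry hS hSS
  have hMdet : IsUnit M.det := (Matrix.isUnit_iff_isUnit_det M).1 hM.isUnit
  have hM1 : M⁻¹ * M = 1 := Matrix.nonsing_inv_mul M hMdet
  have hM2 : M * M⁻¹ = 1 := Matrix.mul_nonsing_inv M hMdet
  have hUS' : Xᴴ * (a * U) = S := by
    have h := congrArg conjTranspose hUS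
    rw [hS.eq, conjTranspose_mul, conjTranspose_conjTranspose, conjTranspose_mul, ha.eq,
      Matrix.mul_assoc] at h
    exact h
  have hUS2 : Uᴴ * a * X = S := by rw [Matrix.mul_assoc, hUS]
  -- The gap in the inequality will be `Tr D* M⁻¹ D + Tr E (a M a) E`. The second term appears
  -- because `R` may be singular, so `U` need not be unitary and `E` is only a projection.
  set D := M * a * U - X with hD
  set E := 1 - U * Uᴴ with hE
  have hEh : Eᴴ = E := by simp [hE]
  have hEE : E * E = E := by
    rw [hE, Matrix.sub_mul, Matrix.mul_sub, Matrix.mul_sub, hU]; simp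
  have hGp : (Dᴴ * M⁻¹ * D).PosSemidef := hM.inv.posSemidef.conjTranspose_mul_mul_same D
  have haMa : (a * M * a).PosDef := posDef_conj hM had
  have hKp : (E * (a * M * a) * E).PosSemidef := by
    have h := haMa.posSemidef.conjTranspose_mul_mul_same E
    rwa [hEh] at h
  have hG : Dᴴ * M⁻¹ * D = Uᴴ * (a * M * a) * U - S - S + X * M⁻¹ * X := by
    have e : Dᴴ = Uᴴ * a * M - X := by
      rw [hD, conjTranspose_sub, conjTranspose_mul, conjTranspose_mul, hM.isHermitian.eq, ha.eq,
        hX.eq, Matrix.mul_assoc]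
    have e1 : Dᴴ * M⁻¹ = Uᴴ * a - X * M⁻¹ := by
      rw [e, Matrix.sub_mul, Matrix.mul_assoc (Uᴴ * a), hM2, Matrix.mul_one]
    have e2 : X * M⁻¹ * (M * a * U) = S := by
      rw [← hUS', hX.eq]
      calc X * M⁻¹ * (M * a * U) = X * (M⁻¹ * M) * (a * U) := by simp only [Matrix.mul_assoc]
        _ = _ := by rw [hM1, Matrix.mul_one]
    rw [e1, hD, Matrix.sub_mul, Matrix.mul_sub, Matrix.mul_sub, e2, hUS2]
    simp only [Matrix.mul_assoc]
    abel
  have hGt : (Dᴴ * M⁻¹ * D).trace =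
      (U * Uᴴ * (a * M * a)).trace - 2 * S.trace + (R * M⁻¹).trace := by
    rw [hG, trace_add, trace_sub, trace_sub, Matrix.mul_assoc Uᴴ, trace_mul_comm Uᴴ,
      trace_mul_comm (X * M⁻¹), ← Matrix.mul_assoc X X, hXX, Matrix.mul_assoc _ U,
      trace_mul_comm _ (U * Uᴴ)]
    ring
  have hKt : (E * (a * M * a) * E).trace = (A * M).trace - (U * Uᴴ * (a * M * a)).trace := by
    rw [trace_mul_comm, ← Matrix.mul_assoc, hEE, hE, Matrix.sub_mul, trace_sub, Matrix.one_mul,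
      trace_mul_comm (a * M), ← Matrix.mul_assoc, haa]
  have hsum : (A * M).trace.re + (R * M⁻¹).trace.re - 2 * S.trace.re =
      (Dᴴ * M⁻¹ * D).trace.re + (E * (a * M * a) * E).trace.re := by
    rw [hGt, hKt]; simp; ring
  have hG0 := Complex.nonneg_iff.1 hGp.trace_nonneg
  have hK0 := Complex.nonneg_iff.1 hKp.trace_nonneg
  refine ⟨by linarith [hG0.1, hK0.1], fun heq => ?_⟩
  have hGz : Dᴴ * M⁻¹ * D = 0 :=
    hGp.trace_eq_zero_iff.1 (Complex.ext (by simp; linarith [hG0.1, hK0.1]) hG0.2.symm)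
  have hKz : E * (a * M * a) * E = 0 :=
    hKp.trace_eq_zero_iff.1 (Complex.ext (by simp; linarith [hG0.1, hK0.1]) hK0.2.symm)
  have key : ∀ {N Z : Matrix (Fin d) (Fin d) ℂ}, N.PosDef → Zᴴ * N * Z = 0 → Z = 0 := by
    intro N Z hN hZ
    have hs := posDef_sqrt hN
    have h : (CFC.sqrt N * Z)ᴴ * (CFC.sqrt N * Z) = 0 := by
      rw [conjTranspose_mul, hs.isHermitian.eq, ← hZ]
      conv_rhs => rw [← CFC.sqrt_mul_sqrt_self N hN.posSemidef.nonneg]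
      simp only [Matrix.mul_assoc]
    have h2 := Matrix.conjTranspose_mul_self_eq_zero.1 h
    exact (hs.isUnit.mul_right_eq_zero).1 h2
  have hD0 : M * a * U = X := sub_eq_zero.1 (key hM.inv hGz)
  -- In the equality case `U` is unitary and cancels from `R = X X*`.
  have hE0 : U * Uᴴ = 1 := (sub_eq_zero.1 (key haMa (by rwa [hEh]))).symm
  calc R = X * Xᴴ := by rw [hX.eq, hXX]
    _ = M * a * (U * Uᴴ) * (a * M) := by
      rw [← hD0, conjTranspose_mul, conjTranspose_mul, hM.isHermitian.eq, ha.eq]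
      simp only [Matrix.mul_assoc]
    _ = M * (a * a) * M := by rw [hE0]; simp only [Matrix.mul_assoc, Matrix.one_mul]
    _ = M * A * M := by rw [haa]

/-- With `X = (M A M)^{1/2}`, the positive matrix `X M⁻¹ X` squares to `X A X`, so it is the root in
the fidelity. -/
lemma fidelity_conj {d : ℕ} {A M : Matrix (Fin d) (Fin d) ℂ} (hA : A.PosDef) (hM : M.PosDef) :
    fidelity A (M * A * M) = (A * M).trace.re := by
  have hRp : (M * A * M).PosDef := posDef_conj hA hM
  have hXp := posDef_sqrt hRp
  have hXX := CFC.sqrt_mul_sqrt_self (M * A * M) hRp.posSemidef.nonneg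
  unfold fidelity
  set X := CFC.sqrt (M * A * M)
  have hMdet : IsUnit M.det := (Matrix.isUnit_iff_isUnit_det M).1 hM.isUnit
  have hM1 : M⁻¹ * M = 1 := Matrix.nonsing_inv_mul M hMdet
  have hM2 : M * M⁻¹ = 1 := Matrix.mul_nonsing_inv M hMdet
  have hsq : X * M⁻¹ * X * (X * M⁻¹ * X) = X * A * X := by
    calc X * M⁻¹ * X * (X * M⁻¹ * X) = X * M⁻¹ * (X * X) * M⁻¹ * X := by
          simp only [Matrix.mul_assoc]
      _ = X * (M⁻¹ * M) * A * (M * M⁻¹) * X := by rw [hXX]; simp only [Matrix.mul_assoc]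
      _ = X * A * X := by rw [hM1, hM2, Matrix.mul_one, Matrix.mul_one]
  rw [CFC.sqrt_unique hsq (posDef_conj hM.inv hXp).posSemidef.nonneg, trace_mul_comm,
    ← Matrix.mul_assoc, hXX, Matrix.mul_assoc, hM2, Matrix.mul_one, trace_mul_comm]

/-- The trace part is constant on decompositions, so minimizing distance is maximizing fidelity. -/
lemma ensembleBuresSq_eq {d n : ℕ} (P : Fin n → Matrix (Fin d) (Fin d) ℂ)
    {Q : Matrix (Fin d) (Fin d) ℂ} {R : Fin n → Matrix (Fin d) (Fin d) ℂ}
    (hR : R ∈ decompositions n Q) :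
    ensembleBuresSq P R = ((∑ i, P i) + Q).trace.re - 2 * ensembleFidelity P R := by
  simp only [ensembleBuresSq, ensembleFidelity, buresSq, Finset.sum_sub_distrib, Finset.mul_sum,
    ← hR.2, ← Finset.sum_add_distrib, trace_sum, Complex.re_sum]

lemma ensembleProjections_eq {d n : ℕ} (P : Fin n → Matrix (Fin d) (Fin d) ℂ)
    (Q : Matrix (Fin d) (Fin d) ℂ) :
    ensembleProjections P Q = ensembleFidelityProjections P Q := by
  ext R
  refine and_congr_right fun hR => ?_
  rw [isMinOn_iff, isMaxOn_iff]
  refine forall₂_congr fun R' hR' => ?_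
  rw [ensembleBuresSq_eq P hR, ensembleBuresSq_eq P hR']
  constructor <;> intro h <;> linarith

lemma ensembleFidelityProjections_eq {d n : ℕ} {P : Fin n → Matrix (Fin d) (Fin d) ℂ}
    (hP : ∀ i, (P i).PosDef) {Q M : Matrix (Fin d) (Fin d) ℂ} (hM : M.PosDef)
    (hMQ : M * (∑ i, P i) * M = Q) :
    ensembleFidelityProjections P Q = {fun i => M * P i * M} := by
  have hmem : (fun i => M * P i * M) ∈ decompositions n Q :=
    ⟨fun i => (posDef_conj (hP i) hM).posSemidef, by
      rw [← Finset.sum_mul, ← Finset.mul_sum, hMQ]⟩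
  have hsum : ∀ R ∈ decompositions n Q,
      ∑ i, ((P i * M).trace.re + (R i * M⁻¹).trace.re) =
        2 * ensembleFidelity P fun i => M * P i * M := by
    intro R hR
    have hMdet : IsUnit M.det := (Matrix.isUnit_iff_isUnit_det M).1 hM.isUnit
    have h1 : ∑ i, (R i * M⁻¹).trace.re = ∑ i, (P i * M).trace.re := by
      rw [← Complex.re_sum, ← Complex.re_sum, ← trace_sum, ← trace_sum, ← Finset.sum_mul,
        ← Finset.sum_mul, hR.2, ← hMQ, Matrix.mul_assoc, Matrix.mul_nonsing_inv M hMdet,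
        Matrix.mul_one, trace_mul_comm]
    rw [Finset.sum_add_distrib, h1, ensembleFidelity,
      Finset.sum_congr rfl fun i _ => fidelity_conj (hP i) hM]
    ring
  have hle : ∀ R ∈ decompositions n Q, ∀ i ∈ Finset.univ,
      2 * fidelity (P i) (R i) ≤ (P i * M).trace.re + (R i * M⁻¹).trace.re :=
    fun R hR i _ => (two_fidelity_le (hP i) (hR.1 i) hM).1
  have hmax : ∀ R ∈ decompositions n Q,
      ensembleFidelity P R ≤ ensembleFidelity P fun i => M * P i * M := by
    intro R hR
    have h := Finset.sum_le_sum (hle R hR)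
    rw [hsum R hR, ← Finset.mul_sum] at h
    exact le_of_mul_le_mul_left h two_pos
  ext R
  rw [Set.mem_singleton_iff]
  constructor
  · rintro ⟨hR, hRmax⟩
    have heq : ∑ i, 2 * fidelity (P i) (R i) =
        ∑ i, ((P i * M).trace.re + (R i * M⁻¹).trace.re) := by
      rw [hsum R hR, ← Finset.mul_sum]
      exact congrArg (2 * ·) (le_antisymm (hmax R hR) (isMaxOn_iff.1 hRmax _ hmem))
    -- Equal sums of termwise bounds force equality in each term.
    funext i
    exact (two_fidelity_le (hP i) (hR.1 i) hM).2
      ((Finset.sum_eq_sum_iff_of_le (hle R hR)).1 heq i (Finset.mem_univ i))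
  · rintro rfl
    exact ⟨hmem, isMaxOn_iff.2 hmax⟩

end BuresProjection

theorem theorem3p6 (d n : ℕ) (hn : 0 < n)
    (P : Fin n → Matrix (Fin d) (Fin d) ℂ) (hP : ∀ i, (P i).PosDef)
    (Q : Matrix (Fin d) (Fin d) ℂ) (hQ : Q.PosDef)
    (M : Matrix (Fin d) (Fin d) ℂ) (hM : M = BuresProjection.geomMean (∑ i, P i)⁻¹ Q) :
    BuresProjection.ensembleProjections P Q = {fun i => M * P i * M} ∧
      BuresProjection.ensembleFidelityProjections P Q = {fun i => M * P i * M} ∧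
      ∀ i, (M * P i * M).PosDef ∧ BuresProjection.starProd (P i) (M ^ 2) = M * P i * M := by
  have hPs : (∑ i, P i).PosDef :=
    Matrix.posDef_sum ⟨⟨0, hn⟩, Finset.mem_univ _⟩ fun i _ => hP i
  have hMp : M.PosDef := hM ▸ BuresProjection.posDef_geomMean hPs.inv hQ
  have hMQ : M * (∑ i, P i) * M = Q := by
    have h := BuresProjection.geomMean_riccati hPs.inv hQ
    rwa [← hM, Matrix.nonsing_inv_nonsing_inv _
      ((Matrix.isUnit_iff_isUnit_det _).1 hPs.isUnit)] at h
  have hF := BuresProjection.ensembleFidelityProjections_eq hP hMp hMQ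
  refine ⟨(BuresProjection.ensembleProjections_eq P Q).trans hF, hF, fun i =>
    ⟨BuresProjection.posDef_conj (hP i) hMp, ?_⟩⟩
  rw [BuresProjection.starProd, CFC.sqrt_sq M hMp.posSemidef.nonneg]
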